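/- Let $N>2$ be an integer. For $\tau$ in the upper half plane $\mathfrak H$ let $\wp(z;L_\tau)$ be the Weierstrass $\wp$-function of the lattice $L_\tau=\mathbb Z+\mathbb Z\tau$, put $q=\exp(2\pi i\tau/N)$, and define $$\Lambda(\tau)=\frac{\wp(\tau/N;L_\tau)-\wp((\tau+1)/N;L_\tau)}{\wp(1/N;L_\tau)-\wp((\tau+1)/N;L_\tau)}.$$ For $A=\begin{pmatrix}x&y\\z&w\end{pmatrix}\in \mathrm{SL}_2(\mathbb Z)$ write $(\Lambda\circ A)(\tau)=\Lambda\left(\frac{x\tau+y}{z\tau+w}\right)$. For an integer $x$ let $\{x\}$ be the integer with $0\le\{x\}\le N/2$ and $x\equiv\pm\{x\}\bmod N$. Let $T=\begin{pmatrix}1&1\\0&1\end{pmatrix}$. For every $A\in\mathrm{SL}_2(\mathbb Z)$ the function $\Lambda\circ A$ has a non-zero $q$-expansion at $i\infty$ (a Laurent series in $q$ with finite principal part, representing the function for all $\tau$ of large imaginary part). Let $\nu(A)\in\mathbb Z$ be its order, that is, the least exponent of $q$ occurring with non-zero coefficient. Then: (i) If $A\equiv\begin{pmatrix}a&*\\c&*\end{pmatrix}\bmod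 N$, then $$\nu(A)=\min(\{a\},\{a+c\})-\min(\{c\},\{a+c\}).$$ (ii) If $A=\begin{pmatrix}x&y\\z&w\end{pmatrix}\in\mathrm{SL}_2(\mathbb Z)$ with $x\not\equiv\pm z\bmod N$, and $A'=\begin{pmatrix}z&-w\\x&-y\end{pmatrix}$, then $\nu(A)=\nu(AT^i)=-\nu(A'T^i)$ for all $i\in\mathbb Z$. (iii) If $A=\begin{pmatrix}x&y\\z&w\end{pmatrix}\in\mathrm{SL}_2(\mathbb Z)$ with $x\equiv z$ or $x\equiv -z\bmod N$, then $\nu(AT^i)=0$ for all $i\in\mathbb Z$. -/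

import Mathlib

open scoped MatrixGroups

namespace GenLambda

open UpperHalfPlane Filter Topology

noncomputable section

/-! ### The generalized lambda function -/

/-- The periods `1, τ`; they generate the lattice `L_τ = ℤ + ℤτ`. -/
def periods (τ : ℍ) : PeriodPair where
  ω₁ := 1
  ω₂ := (τ : ℂ)
  indep := by
    rw [LinearIndependent.pair_iff]
    intro s t h
    have him := congrArg Complex.im h
    have hre := congrArg Complex.re h
    have hτ : (τ : ℂ).im ≠ 0 := τ.im_ne_zero
    simp at him hre
    have ht : t = 0 := him.resolve_right (by simpa using hτ)
    subst ht
    simpa using hre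

/-- The value of the Weierstrass function `℘(z; L_τ)` at the `N`-division point
`φ_τ(Q) = (rτ + s)/N mod L_τ` attached to `Q = (r, s) ∈ ℤ/N ⊕ ℤ/N`. As `℘` has period lattice
`L_τ`, the representatives of `r` and `s` do not matter, see `wp_intCast`. -/
def wp (N : ℕ) (τ : ℍ) (Q : ZMod N × ZMod N) : ℂ :=
  (periods τ).weierstrassP (((Q.1.val : ℂ) * (τ : ℂ) + (Q.2.val : ℂ)) / (N : ℂ))

theorem wp_intCast (N : ℕ) (hN : 0 < N) (τ : ℍ) (r s : ℤ) :
    wp N τ ((r : ZMod N), (s : ZMod N)) =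
      (periods τ).weierstrassP (((r : ℂ) * (τ : ℂ) + (s : ℂ)) / (N : ℂ)) := by
  have : NeZero N := ⟨hN.ne'⟩
  have hNC : (N : ℂ) ≠ 0 := by exact_mod_cast hN.ne'
  have key : ∀ x : ℤ, ((x : ZMod N).val : ℂ) = (x : ℂ) - (N : ℂ) * ((x / (N : ℤ) : ℤ) : ℂ) := by
    intro x
    have h1 : (((x : ZMod N).val : ℕ) : ℤ) = x - (N : ℤ) * (x / (N : ℤ)) := by
      rw [ZMod.val_intCast, Int.emod_def]
    have h2 := congrArg (fun y : ℤ => (y : ℂ)) h1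
    push_cast at h2
    exact h2
  have hmem : (((s / (N : ℤ) : ℤ) : ℂ) + ((r / (N : ℤ) : ℤ) : ℂ) * (τ : ℂ)) ∈
      (periods τ).lattice :=
    PeriodPair.mem_lattice.mpr ⟨s / (N : ℤ), r / (N : ℤ), by simp [periods]⟩
  have h := (periods τ).weierstrassP_sub_coe (((r : ℂ) * (τ : ℂ) + (s : ℂ)) / (N : ℂ)) ⟨_, hmem⟩
  rw [← h]
  unfold wp
  congr 1
  simp only [key]
  field_simp
  ring

/-- The generalized lambda function `Λ(τ; Q₁, Q₂)` of level `N`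
(meaningful when `Q₁, Q₂` is a basis of `ℤ/N ⊕ ℤ/N`). -/
def LambdaQ (N : ℕ) (Q₁ Q₂ : ZMod N × ZMod N) (τ : ℍ) : ℂ :=
  (wp N τ Q₁ - wp N τ (Q₁ + Q₂)) / (wp N τ Q₂ - wp N τ (Q₁ + Q₂))

/-- `Λ(τ) = Λ(τ; (1,0), (0,1))`. -/
def Lambda (N : ℕ) : ℍ → ℂ := LambdaQ N (1, 0) (0, 1)

/-- `f ∘ A`, that is `τ ↦ f ((aτ + b)/(cτ + d))`. -/
def compAct (f : ℍ → ℂ) (A : SL(2, ℤ)) : ℍ → ℂ := fun τ => f (A • τ)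

/-! ### `q`-expansions at `i∞`, with `q = exp(2πiτ/N)` -/

/-- `q = exp(2πiτ/N)`. -/
def qN (N : ℕ) (τ : ℍ) : ℂ := Complex.exp (2 * Real.pi * Complex.I * (τ : ℂ) / (N : ℂ))

/-- The Laurent series `F` (with finite principal part) is the `q`-expansion of `f` :
`f(τ) = ∑ₙ Fₙ qⁿ` whenever the imaginary part of `τ` is large enough. -/
def HasQExpansion (N : ℕ) (f : ℍ → ℂ) (F : LaurentSeries ℂ) : Prop :=
  ∀ᶠ τ : ℍ in atImInfty, HasSum (fun n : ℤ => F.coeff n * qN N τ ^ n) (f τ)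

theorem eq_zero_of_hasQExpansion_zero {N : ℕ} (hN : 0 < N) {F : LaurentSeries ℂ}
    (hF : HasQExpansion N (fun _ => 0) F) : F = 0 := by
  by_contra hne
  have hNR : (0 : ℝ) < (N : ℝ) := by exact_mod_cast hN
  obtain ⟨B, hB⟩ := (atImInfty_mem _).mp hF
  set m := F.order with hm
  have hz : ∀ᶠ z : ℂ in 𝓝 0, z ≠ 0 → HasSum (fun n : ℤ => F.coeff n * z ^ n) 0 := by
    have hev : ∀ᶠ z : ℂ in 𝓝 0, ‖z‖ < Real.exp (-2 * Real.pi * (max B 0) / (N : ℝ)) := by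
      have : Tendsto (fun z : ℂ => ‖z‖) (𝓝 0) (𝓝 0) := tendsto_norm_zero
      exact this.eventually (gt_mem_nhds (Real.exp_pos _))
    filter_upwards [hev] with z hz1 hz0
    have hq := Function.Periodic.qParam_right_inv hNR.ne' hz0
    rw [← hq, Function.Periodic.norm_qParam_lt_iff hNR] at hz1
    have h := hB ⟨_, lt_of_le_of_lt (le_max_right B 0) hz1⟩
      (le_trans (le_max_left B 0) hz1.le)
    have e : qN N ⟨_, lt_of_le_of_lt (le_max_right B 0) hz1⟩ = z := by
      conv_rhs => rw [← hq]
      simp [qN, Function.Periodic.qParam]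
    simpa only [e] using (show HasSum _ _ from h)
  let g : ℂ → ℂ := fun z => if z = 0 then F.coeff m else 0
  have hg : HasFPowerSeriesAt g
      (FormalMultilinearSeries.ofScalars ℂ (fun n : ℕ => F.coeff (m + n))) 0 := by
    rw [hasFPowerSeriesAt_iff]
    filter_upwards [hz] with z hz
    simp only [FormalMultilinearSeries.coeff_ofScalars, zero_add, smul_eq_mul]
    by_cases h0 : z = 0
    · subst h0
      have := hasSum_single (f := fun n : ℕ => (0 : ℂ) ^ n * F.coeff (m + n)) 0
        (fun n hn => by simp [hn])
      simpa [g] using this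
    · have h1 := (hz h0).mul_left (z ^ (-m))
      have hinj : Function.Injective (fun n : ℕ => m + (n : ℤ)) := fun a b h => by simpa using h
      have h2 := (hinj.hasSum_iff (f := fun n : ℤ => z ^ (-m) * (F.coeff n * z ^ n)) ?_).mpr h1
      · simp only [g, h0, if_false]
        rw [mul_zero] at h2
        refine h2.congr_fun ?_
        intro n
        simp only [Function.comp]
        rw [zpow_add₀ h0, zpow_neg, zpow_natCast]
        have := zpow_ne_zero m h0
        field_simp
      · intro n hn
        have : n < m := by
          by_contra hlt
          exact hn ⟨(n - m).toNat, by simp; omega⟩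
        simp [HahnSeries.coeff_eq_zero_of_lt_order this]
  have hlim : Tendsto g (𝓝[≠] 0) (𝓝 (F.coeff m)) := by
    have := hg.continuousAt.tendsto.mono_left (nhdsWithin_le_nhds (s := {(0 : ℂ)}ᶜ))
    simpa [g] using this
  have hlim0 : Tendsto g (𝓝[≠] 0) (𝓝 0) := by
    refine tendsto_const_nhds.congr' ?_
    filter_upwards [self_mem_nhdsWithin] with z hz
    have : z ≠ 0 := hz
    simp [g, this]
  exact hne (HahnSeries.coeff_order_eq_zero.mp (tendsto_nhds_unique hlim hlim0))

/-- A function has at most one `q`-expansion. -/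
theorem HasQExpansion.unique {N : ℕ} (hN : 0 < N) {f : ℍ → ℂ} {F G : LaurentSeries ℂ}
    (hF : HasQExpansion N f F) (hG : HasQExpansion N f G) : F = G := by
  refine sub_eq_zero.mp (eq_zero_of_hasQExpansion_zero hN ?_)
  filter_upwards [hF, hG] with τ h1 h2
  have h := h1.sub h2
  simp only [sub_self] at h
  simpa only [HahnSeries.coeff_sub, sub_mul] using h

open Classical in
/-- The `q`-expansion of `f` (set to `0` if `f` has none). -/
def qExpansion (N : ℕ) (f : ℍ → ℂ) : LaurentSeries ℂ :=
  if h : ∃ F, HasQExpansion N f F then h.choose else 0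

theorem HasQExpansion.qExpansion_eq {N : ℕ} (hN : 0 < N) {f : ℍ → ℂ} {F : LaurentSeries ℂ}
    (hF : HasQExpansion N f F) : qExpansion N f = F := by
  have h : ∃ F, HasQExpansion N f F := ⟨F, hF⟩
  rw [qExpansion, dif_pos h]
  exact h.choose_spec.unique hN hF

/-- `ν(A)`: the order of the `q`-expansion of `Λ ∘ A`, i.e. the least exponent of `q` that occurs
in it with a non-zero coefficient. -/
def nu (N : ℕ) (A : SL(2, ℤ)) : ℤ := (qExpansion N (compAct (Lambda N) A)).order

end

/-! ### The integer `{x}` and the pairing of matrices -/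

/-- `{x}`: the distance from `x` to the nearest multiple of `N`. -/
def br (N : ℕ) (x : ℤ) : ℤ := min (x % (N : ℤ)) ((N : ℤ) - x % (N : ℤ))

/-- `{x}` is the unique integer with `0 ≤ {x} ≤ N/2` and `x ≡ ±{x} mod N`. -/
theorem br_eq_iff (N : ℕ) (hN : 0 < N) (x y : ℤ) :
    br N x = y ↔ 0 ≤ y ∧ 2 * y ≤ (N : ℤ) ∧ (x ≡ y [ZMOD N] ∨ x ≡ -y [ZMOD N]) := by
  have hN' : (0 : ℤ) < (N : ℤ) := by exact_mod_cast hN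
  have h0 := Int.emod_nonneg x hN'.ne'
  have h1 := Int.emod_lt_of_pos x hN'
  have hx := Int.emod_add_mul_ediv x (N : ℤ)
  constructor
  · rintro rfl
    refine ⟨by unfold br; omega, by unfold br; omega, ?_⟩
    unfold br
    rcases le_total (x % (N : ℤ)) ((N : ℤ) - x % (N : ℤ)) with h | h
    · rw [min_eq_left h]
      exact Or.inl (Int.mod_modEq x N).symm
    · rw [min_eq_right h]
      right
      refine (Int.modEq_iff_dvd.mpr ⟨-1 - x / (N : ℤ), ?_⟩)
      linear_combination hx
  · rintro ⟨hy0, hy1, hy | hy⟩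
    · have : x % (N : ℤ) = y := by
        rw [hy]; exact Int.emod_eq_of_lt hy0 (by omega)
      unfold br; omega
    · rcases hy0.eq_or_lt with rfl | hpos
      · have : x % (N : ℤ) = 0 := by rw [hy]; simp
        unfold br; omega
      · have : x % (N : ℤ) = (N : ℤ) - y := by
          have e : x % (N : ℤ) = ((N : ℤ) - y) % (N : ℤ) := by
            rw [hy]; exact (Int.modEq_iff_dvd.mpr ⟨1, by ring⟩)
          rw [e]; exact Int.emod_eq_of_lt (by omega) (by omega)
        unfold br; omega

/-- For `A = (x y; z w)` the matrix `A' = (z -w; x -y)`; if `A` represents the cusp `(a, c)`, then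
`A'` represents the cusp `(c, a)`. -/
def partner (A : SL(2, ℤ)) : SL(2, ℤ) :=
  ⟨!![A 1 0, -A 1 1; A 0 0, -A 0 1], by
    have h := A.det_coe
    rw [Matrix.det_fin_two] at h
    rw [Matrix.det_fin_two_of]
    linear_combination h⟩

end GenLambda

/-!
The proof computes the behaviour in `q` of a difference of two values of `℘` at `N`-division
points and takes quotients.

By homogeneity of `℘`, the function `Λ ∘ A` for `A = (x y; z w)` is
`(℘_P - ℘_{P+R}) / (℘_R - ℘_{P+R})` with `P = (x, y)` and `R = (z, w)`, where `℘_{(r, s)}` stands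
for `℘((rτ + s)/N; L_τ)`; the automorphy factors cancel (`compAct_Lambda`).

In a difference of two values of `℘` the convergence terms `1 / l²` cancel, and the sum over the
period `1` is given by the Lipschitz formula `∑ₙ 1 / (w - n)² = (2πi)² u / (1 - u)²` with
`u = exp (2πiw)` (`hasSum_one_div_sub_int_sq`). So, up to `(2πi)²`, the difference
`℘_{(r, s)} - ℘_{(r', s')}` is `Φ_{r, s}(q) - Φ_{r', s'}(q)`, where `Φ_{r, s}(q)` is the sum of
`u / (1 - u)²` over `u = q ^ (r - mN) η`, `m ∈ ℤ`, with `η = exp (2πis/N)`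
(`hasSum_weierstrassP_sub`).

Since `℘` is even and periodic, one may take `0 ≤ r ≤ N / 2`, that is `r = {r}`. As `u / (1 - u)²`
is invariant under `u ↦ u⁻¹`, the series is then `q ^ r` times a function that is analytic at
`q = 0`, whose value there is `η / (1 - η)²`, `η + η⁻¹` or `η` according to whether `r = 0`,
`r = N / 2` or neither (`exists_analyticAt_hasSum_koebe_int`). If `r ≠ r'`, the lower power of `q`
has a non-zero coefficient; if `r = r'`, the two coefficients differ, because the two points form
a basis of `(ℤ/N)²`. Hence the difference has order exactly `min ({r}, {r'})` (`exists_wp_sub`),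
and the formula for `ν(A)` follows (`nu_eq`). The other assertions are read off from this formula,
as multiplication by `T ^ i` does not change the first column of `A`, and `{-x} = {x}`.
-/

namespace GenLambda

open UpperHalfPlane Filter Topology

/-! ### The Koebe function and the Lipschitz formula -/

/-- The Koebe function `u ↦ u / (1 - u)²`. -/
noncomputable def koebe (u : ℂ) : ℂ := u / (1 - u) ^ 2

theorem koebe_inv (u : ℂ) : koebe u⁻¹ = koebe u := by
  by_cases h0 : u = 0
  · simp [h0]
  by_cases h1 : u = 1
  · simp [h1]
  have h2 : 1 - u ≠ 0 := sub_ne_zero.mpr (Ne.symm h1)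
  have h3 : u - 1 ≠ 0 := sub_ne_zero.mpr h1
  unfold koebe
  have : 1 - u⁻¹ = (u - 1) / u := by field_simp
  rw [this]
  field_simp
  ring

theorem summable_one_div_sub_int_sq (w : ℂ) : Summable fun n : ℤ => 1 / (w - n) ^ 2 := by
  have h := EisensteinSeries.linear_right_summable (-w) 1 (k := 2) le_rfl
  refine h.congr fun n => ?_
  rw [one_div, ← neg_sq (w - n), show ((2 : ℤ)) = ((2 : ℕ) : ℤ) from rfl, zpow_natCast]
  congr 2
  push_cast
  ring

theorem tsum_one_div_sub_int_sq_of_im_pos {w : ℂ} (hw : 0 < w.im) :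
    ∑' n : ℤ, 1 / (w - n) ^ 2 =
      (2 * Real.pi * Complex.I) ^ 2 * koebe (Complex.exp (2 * Real.pi * Complex.I * w)) := by
  have h := EisensteinSeries.qExpansion_identity le_rfl (⟨w, hw⟩ : ℍ)
  have hn : ‖Complex.exp (2 * Real.pi * Complex.I * w)‖ < 1 := by
    rw [Complex.norm_exp, Real.exp_lt_one_iff]
    have : (2 * Real.pi * Complex.I * w).re = -(2 * Real.pi * w.im) := by simp
    rw [this]
    have := Real.pi_pos
    nlinarith [mul_pos this hw]
  rw [← (Equiv.neg ℤ).tsum_eq]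
  simp only [Equiv.neg_apply, Int.cast_neg, sub_neg_eq_add]
  have h2 := tsum_coe_mul_geometric_of_norm_lt_one hn
  simp only [Nat.reduceAdd, pow_one] at h
  unfold koebe
  rw [← h2]
  refine h.trans ?_
  simp

/-- The Lipschitz formula on the real line, as a limit from the upper half plane. -/
theorem tsum_one_div_sub_int_sq_of_im_eq_zero {w : ℂ} (hw : w.im = 0)
    (hint : ∀ n : ℤ, w ≠ n) :
    ∑' n : ℤ, 1 / (w - n) ^ 2 =
      (2 * Real.pi * Complex.I) ^ 2 * koebe (Complex.exp (2 * Real.pi * Complex.I * w)) := by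
  have hne : 1 - Complex.exp (2 * Real.pi * Complex.I * w) ≠ 0 := by
    rw [sub_ne_zero, ne_comm, Ne, Complex.exp_eq_one_iff]
    rintro ⟨n, hn⟩
    refine hint n ?_
    have : (2 * Real.pi * Complex.I : ℂ) ≠ 0 := Complex.two_pi_I_ne_zero
    exact mul_left_cancel₀ this (by rw [hn]; ring)
  have hpath : Tendsto (fun ε : ℝ => w + ε * Complex.I) (𝓝[>] 0) (𝓝 w) := by
    have : Continuous fun ε : ℝ => w + ε * Complex.I := by fun_prop
    simpa using (this.tendsto 0).mono_left nhdsWithin_le_nhds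
  have h1 : Tendsto (fun ε : ℝ => ∑' n : ℤ, 1 / (w + ε * Complex.I - n) ^ 2) (𝓝[>] 0)
      (𝓝 (∑' n : ℤ, 1 / (w - n) ^ 2)) := by
    refine tendsto_tsum_of_dominated_convergence (summable_one_div_sub_int_sq w).norm
      (fun n => ?_) (Eventually.of_forall fun ε n => ?_)
    · refine tendsto_const_nhds.div ((hpath.sub_const _).pow 2) ?_
      exact pow_ne_zero _ (sub_ne_zero.mpr (hint n))
    · rw [norm_div, norm_div, norm_pow, norm_pow]
      have hpos : 0 < ‖w - n‖ := norm_pos_iff.mpr (sub_ne_zero.mpr (hint n))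
      gcongr
      rw [← sq_le_sq₀ hpos.le (norm_nonneg _), ← Complex.normSq_eq_norm_sq,
        ← Complex.normSq_eq_norm_sq, Complex.normSq_apply, Complex.normSq_apply]
      simp [hw]
      nlinarith [mul_self_nonneg ε]
  have h2 : Tendsto (fun ε : ℝ => (2 * Real.pi * Complex.I) ^ 2 *
      koebe (Complex.exp (2 * Real.pi * Complex.I * (w + ε * Complex.I)))) (𝓝[>] 0)
      (𝓝 ((2 * Real.pi * Complex.I) ^ 2 *
        koebe (Complex.exp (2 * Real.pi * Complex.I * w)))) := by
    have he : Tendsto (fun ε : ℝ => Complex.exp (2 * Real.pi * Complex.I * (w + ε * Complex.I)))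
        (𝓝[>] 0) (𝓝 (Complex.exp (2 * Real.pi * Complex.I * w))) :=
      (Complex.continuous_exp.tendsto _).comp (hpath.const_mul _)
    exact (he.div ((tendsto_const_nhds.sub he).pow 2) (pow_ne_zero _ hne)).const_mul _
  refine tendsto_nhds_unique (h1.congr' ?_) h2
  filter_upwards [self_mem_nhdsWithin] with ε hε
  refine tsum_one_div_sub_int_sq_of_im_pos ?_
  have : 0 < ε := hε
  simpa [hw] using this

/-- The Lipschitz formula for the exponent `2`, at every complex number that is not an integer. -/
theorem hasSum_one_div_sub_int_sq {w : ℂ} (hint : ∀ n : ℤ, w ≠ n) :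
    HasSum (fun n : ℤ => 1 / (w - n) ^ 2)
      ((2 * Real.pi * Complex.I) ^ 2 * koebe (Complex.exp (2 * Real.pi * Complex.I * w))) := by
  rcases lt_trichotomy w.im 0 with hw | hw | hw
  · have h := (summable_one_div_sub_int_sq (-w)).hasSum
    rw [tsum_one_div_sub_int_sq_of_im_pos (by simpa using hw), mul_neg, Complex.exp_neg,
      koebe_inv] at h
    rw [← (Equiv.neg ℤ).hasSum_iff]
    refine h.congr_fun fun n => ?_
    simp only [Function.comp_apply, Equiv.neg_apply, Int.cast_neg]
    rw [← neg_sq (w - -(n : ℂ))]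
    congr 2
    ring
  · rw [← tsum_one_div_sub_int_sq_of_im_eq_zero hw hint]
    exact (summable_one_div_sub_int_sq w).hasSum
  · rw [← tsum_one_div_sub_int_sq_of_im_pos hw]
    exact (summable_one_div_sub_int_sq w).hasSum

/-! ### Differences of values of `℘` -/

/-- Summing first over the period `1` and then over the period `τ` turns a difference of values
of `℘` into a sum over `ℤ`. The terms `1 / l²` of the series for `℘`, which make it converge,
cancel in the difference. -/
theorem hasSum_weierstrassP_sub (τ : ℍ) {z z' : ℂ} (hz : z ∉ (periods τ).lattice)
    (hz' : z' ∉ (periods τ).lattice) :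
    HasSum (fun m : ℤ => (2 * Real.pi * Complex.I) ^ 2 *
        (koebe (Complex.exp (2 * Real.pi * Complex.I * (z - m * τ))) -
          koebe (Complex.exp (2 * Real.pi * Complex.I * (z' - m * τ)))))
      ((periods τ).weierstrassP z - (periods τ).weierstrassP z') := by
  have hnot : ∀ {z : ℂ}, z ∉ (periods τ).lattice → ∀ m n : ℤ, z - m * τ ≠ n := by
    intro z hz m n h
    exact hz (PeriodPair.mem_lattice.mpr ⟨n, m, by simp [periods, ← h]⟩)
  have h := ((periods τ).hasSum_weierstrassP z).sub ((periods τ).hasSum_weierstrassP z')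
  rw [← ((Equiv.prodComm ℤ ℤ).trans (periods τ).latticeEquivProd.symm.toEquiv).hasSum_iff] at h
  have hcoe : ∀ m n : ℤ, (((periods τ).latticeEquivProd.symm (n, m) : (periods τ).lattice) : ℂ) =
      m * τ + n := by
    intro m n
    rw [PeriodPair.latticeEquiv_symm_apply]
    simp [periods, add_comm]
  refine h.prod_fiberwise fun m => ?_
  have h1 := (hasSum_one_div_sub_int_sq (hnot hz m)).sub (hasSum_one_div_sub_int_sq (hnot hz' m))
  rw [← mul_sub] at h1
  refine h1.congr_fun fun n => ?_
  simp only [Function.comp_apply, Equiv.trans_apply, Equiv.prodComm_apply, Prod.swap_prod_mk,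
    LinearEquiv.coe_toEquiv, hcoe, sub_sub]
  ring

/-- Homogeneity of `℘` of degree `-2` in the lattice. -/
theorem weierstrassP_of_lattice_smul {L M : PeriodPair} {c : ℂ} (hc : c ≠ 0)
    (h : ∀ x : ℂ, x ∈ L.lattice ↔ c * x ∈ M.lattice) (z : ℂ) :
    L.weierstrassP z = c ^ 2 * M.weierstrassP (c * z) := by
  have hM := ((Equiv.mulLeft₀ c hc).subtypeEquiv h).hasSum_iff.mpr (M.hasSum_weierstrassP (c * z))
  refine (L.hasSum_weierstrassP z).unique ((hM.mul_left (c ^ 2)).congr_fun fun l => ?_)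
  have hl : (((Equiv.mulLeft₀ c hc).subtypeEquiv h l : M.lattice) : ℂ) = c * l := rfl
  simp only [Function.comp_apply, hl, ← mul_sub, mul_pow, one_div, mul_inv]
  rw [← mul_assoc, mul_inv_cancel₀ (pow_ne_zero 2 hc), one_mul]

/-! ### `q`-expansions of functions that are meromorphic in `q` -/

theorem tendsto_qN {N : ℕ} (hN : 0 < N) : Tendsto (qN N) atImInfty (𝓝[≠] 0) := by
  have hNR : (0 : ℝ) < (N : ℝ) := by exact_mod_cast hN
  refine ((Function.Periodic.qParam_tendsto hNR).comp tendsto_coe_atImInfty).congr fun τ => ?_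
  simp [qN, Function.Periodic.qParam]

/-- A function of `q` of the shape `q ^ k * H q`, with `H` analytic and non-zero at `0`, has a
`q`-expansion of order `k`. -/
theorem exists_hasQExpansion_of_analyticAt {N : ℕ} (hN : 0 < N) {f : ℍ → ℂ} {H : ℂ → ℂ} {k : ℤ}
    (hH : AnalyticAt ℂ H 0) (hH0 : H 0 ≠ 0)
    (hf : ∀ᶠ τ in atImInfty, f τ = qN N τ ^ k * H (qN N τ)) :
    ∃ F : LaurentSeries ℂ, F ≠ 0 ∧ HasQExpansion N f F ∧ F.order = k := by
  obtain ⟨p, hp⟩ := hH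
  rw [hasFPowerSeriesAt_iff] at hp
  have hp0 : p.coeff 0 = H 0 := by
    have h1 := hp.self_of_nhds
    simp only [zero_add] at h1
    refine (hasSum_single 0 fun n hn => ?_).unique h1 |>.symm ▸ ?_
    all_goals simp_all
  let F : LaurentSeries ℂ := HahnSeries.ofSuppBddBelow
    (fun n => if k ≤ n then p.coeff (n - k).toNat else 0)
    ⟨k, fun n hn => by
      by_contra hlt
      simp only [Function.mem_support, ne_eq, ite_eq_right_iff, Classical.not_imp] at hn
      exact hlt hn.1⟩
  have hFc : ∀ n, F.coeff n = if k ≤ n then p.coeff (n - k).toNat else 0 := fun n => rfl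
  have hFk : F.coeff k ≠ 0 := by simpa [hFc, hp0] using hH0
  have hF0 : F ≠ 0 := by
    rintro h
    simp [h] at hFk
  refine ⟨F, hF0, ?_, le_antisymm (HahnSeries.order_le_of_coeff_ne_zero hFk) ?_⟩
  · filter_upwards [hf, (tendsto_qN hN).eventually (hp.filter_mono nhdsWithin_le_nhds)] with τ h1 h2
    have hq : qN N τ ≠ 0 := Complex.exp_ne_zero _
    rw [h1]
    have hinj : Function.Injective (fun n : ℕ => k + (n : ℤ)) := fun a b h => by simpa using h
    rw [zero_add] at h2
    refine (hinj.hasSum_iff ?_).mp ((h2.mul_left (qN N τ ^ k)).congr_fun fun n => ?_)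
    · intro n hn
      have : ¬ k ≤ n := fun hle => hn ⟨(n - k).toNat, by simp; omega⟩
      simp [hFc, this]
    · simp only [Function.comp_apply, hFc, smul_eq_mul]
      rw [if_pos (by omega), zpow_add₀ hq, zpow_natCast]
      simp
      ring
  · by_contra hlt
    have := (HahnSeries.coeff_order_eq_zero (x := F)).not.mpr hF0
    rw [hFc, if_neg (by omega)] at this
    exact this rfl

/-! ### The sum over the period `τ` as a function of `q` -/

/-- After division by `q ^ a` the terms are dominated by a geometric series near `q = 0`. -/
theorem exists_analyticAt_hasSum_koebe {N a : ℕ} (hN : 0 < N) (ha : 0 < a) {η : ℂ}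
    (hη : ‖η‖ = 1) :
    ∃ R : ℂ → ℂ, AnalyticAt ℂ R 0 ∧ R 0 = η ∧
      ∀ᶠ q in 𝓝 0, HasSum (fun k : ℕ => koebe (q ^ (a + k * N) * η)) (q ^ a * R q) := by
  let f : ℕ → ℂ → ℂ := fun k q => q ^ (k * N) * η / (1 - q ^ (a + k * N) * η) ^ 2
  have hden : ∀ (k : ℕ) (q : ℂ), q ∈ Metric.ball (0 : ℂ) (1 / 2) →
      1 / 2 ≤ ‖1 - q ^ (a + k * N) * η‖ := by
    intro k q hq
    have hq' : ‖q‖ ≤ 1 / 2 := (mem_ball_zero_iff.mp hq).le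
    have h1 : ‖q ^ (a + k * N) * η‖ ≤ 1 / 2 := by
      rw [norm_mul, norm_pow, hη, mul_one]
      calc ‖q‖ ^ (a + k * N) ≤ ‖q‖ ^ 1 :=
            pow_le_pow_of_le_one (norm_nonneg _) (by linarith) (by omega)
        _ ≤ 1 / 2 := by simpa using hq'
    have h2 := norm_sub_norm_le (1 : ℂ) (q ^ (a + k * N) * η)
    rw [norm_one] at h2
    linarith
  have hbound : ∀ (k : ℕ) (q : ℂ), q ∈ Metric.ball (0 : ℂ) (1 / 2) →
      ‖f k q‖ ≤ 4 * (1 / 2 : ℝ) ^ k := by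
    intro k q hq
    have hq' : ‖q‖ ≤ 1 / 2 := (mem_ball_zero_iff.mp hq).le
    have h1 : ‖q‖ ^ (k * N) ≤ (1 / 2 : ℝ) ^ k := by
      calc ‖q‖ ^ (k * N) ≤ ‖q‖ ^ k :=
            pow_le_pow_of_le_one (norm_nonneg _) (by linarith) (Nat.le_mul_of_pos_right k hN)
        _ ≤ _ := by gcongr
    have h2 : (1 / 2 : ℝ) ^ 2 ≤ ‖1 - q ^ (a + k * N) * η‖ ^ 2 := by
      gcongr
      exact hden k q hq
    simp only [f]
    rw [norm_div, norm_mul, hη, mul_one, norm_pow, norm_pow, div_le_iff₀ (by linarith)]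
    calc ‖q‖ ^ (k * N) ≤ (1 / 2 : ℝ) ^ k := h1
      _ = 4 * (1 / 2 : ℝ) ^ k * (1 / 2 : ℝ) ^ 2 := by ring
      _ ≤ _ := by gcongr
  have hsum : Summable fun k : ℕ => 4 * (1 / 2 : ℝ) ^ k :=
    (summable_geometric_of_lt_one (by norm_num) (by norm_num)).mul_left 4
  have hball : Metric.ball (0 : ℂ) (1 / 2) ∈ 𝓝 0 := Metric.ball_mem_nhds _ (by norm_num)
  refine ⟨fun q => ∑' k, f k q, ?_, ?_, ?_⟩
  · refine (Complex.differentiableOn_tsum_of_summable_norm hsum (fun k q hq => ?_)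
      Metric.isOpen_ball hbound).analyticAt hball
    refine DifferentiableAt.differentiableWithinAt ?_
    have hne : (1 - q ^ (a + k * N) * η) ^ 2 ≠ 0 := by
      refine pow_ne_zero 2 (norm_pos_iff.mp ?_)
      linarith [hden k q hq]
    fun_prop (disch := exact hne)
  · have : ∀ k : ℕ, k ≠ 0 → f k 0 = 0 := by
      intro k hk
      simp [f, hk, hN.ne']
    simp only
    rw [tsum_eq_single 0 this]
    simp [f, ha.ne']
  · filter_upwards [hball] with q hq
    have h := (Summable.of_norm_bounded hsum fun k => hbound k q hq).hasSum.mul_left (q ^ a)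
    refine h.congr_fun fun k => ?_
    simp only [f, koebe, pow_add]
    ring

/-- For `0 ≤ r ≤ N / 2` the terms of the sum over `m` with the lowest powers of `q` are those for
`m = 0` and, if `2 r = N`, also for `m = 1`. -/
theorem exists_analyticAt_hasSum_koebe_int {N r : ℕ} (hN : 0 < N) (hr : 2 * r ≤ N) {η : ℂ}
    (hη : ‖η‖ = 1) :
    ∃ H : ℂ → ℂ, AnalyticAt ℂ H 0 ∧
      H 0 = (if r = 0 then koebe η else if 2 * r = N then η + η⁻¹ else η) ∧
      ∀ᶠ q in 𝓝[≠] 0, HasSum (fun m : ℤ => koebe (q ^ ((r : ℤ) - m * N) * η)) (q ^ r * H q) := by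
  obtain ⟨R, hR, hR0, hRs⟩ :=
    exists_analyticAt_hasSum_koebe (a := N + r) hN (by omega) hη
  obtain ⟨R', hR', hR'0, hR's⟩ :=
    exists_analyticAt_hasSum_koebe (a := N - r) (η := η⁻¹) hN (by omega) (by simp [hη])
  have hK : AnalyticAt ℂ (fun q : ℂ => η / (1 - q ^ r * η) ^ 2) 0 := by
    rcases Nat.eq_zero_or_pos r with rfl | hr0
    · simp only [pow_zero]
      exact analyticAt_const
    · have : (1 - (0 : ℂ) ^ r * η) ^ 2 ≠ 0 := by simp [hr0.ne']
      fun_prop (disch := exact this)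
  refine ⟨fun q => η / (1 - q ^ r * η) ^ 2 + q ^ N * R q + q ^ (N - 2 * r) * R' q, ?_, ?_, ?_⟩
  · fun_prop
  · simp only [hR'0, zero_pow hN.ne', zero_mul, add_zero]
    split_ifs with h0 h1
    · simp [h0, koebe, hN.ne']
    · simp [h0, h1]
    · have : N - 2 * r ≠ 0 := by omega
      simp [h0, this]
  · filter_upwards [hRs.filter_mono nhdsWithin_le_nhds, hR's.filter_mono nhdsWithin_le_nhds,
      self_mem_nhdsWithin] with q h1 h2 hq
    have hq : q ≠ 0 := hq
    have h := HasSum.of_add_one_of_neg_add_one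
      (f := fun m : ℤ => koebe (q ^ ((r : ℤ) - m * N) * η))
      (h2.congr_fun fun k => ?_) (h1.congr_fun fun k => ?_)
    · convert h using 1
      have e1 : q ^ (N - r) = q ^ r * q ^ (N - 2 * r) := by rw [← pow_add]; congr 1; omega
      simp only [zero_mul, sub_zero, zpow_natCast, koebe, e1, pow_add]
      ring
    · rw [← koebe_inv, mul_inv, ← zpow_neg, ← zpow_natCast]
      congr 3
      push_cast [show r ≤ N by omega]
      ring
    · rw [← zpow_natCast]
      congr 3
      push_cast
      ring

/-! ### Expansion of a difference of division values -/

/-- The root of unity `exp (2πis/N)`. -/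
noncomputable def rootN (N : ℕ) (s : ℤ) : ℂ := Complex.exp (2 * Real.pi * Complex.I * s / N)

theorem norm_rootN (N : ℕ) (s : ℤ) : ‖rootN N s‖ = 1 := by
  have : (2 * Real.pi * Complex.I * s / N : ℂ) = ((2 * Real.pi * s / N : ℝ) : ℂ) * Complex.I := by
    push_cast
    ring
  rw [rootN, this, Complex.norm_exp_ofReal_mul_I]

theorem rootN_eq_iff {N : ℕ} (hN : 0 < N) (s t : ℤ) :
    rootN N s = rootN N t ↔ (N : ℤ) ∣ s - t := by
  have hp := Complex.isPrimitiveRoot_exp N hN.ne'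
  rw [← hp.zpow_eq_one_iff_dvd, ← Complex.exp_int_mul, rootN, rootN,
    ← div_eq_one_iff_eq (Complex.exp_ne_zero _), ← Complex.exp_sub]
  push_cast
  ring_nf

theorem rootN_add (N : ℕ) (s t : ℤ) : rootN N (s + t) = rootN N s * rootN N t := by
  rw [rootN, rootN, rootN, ← Complex.exp_add]
  push_cast
  ring_nf

theorem rootN_zero (N : ℕ) : rootN N 0 = 1 := by simp [rootN]

theorem rootN_ne_zero (N : ℕ) (s : ℤ) : rootN N s ≠ 0 := Complex.exp_ne_zero _

theorem exp_division_point {N : ℕ} (hN : 0 < N) (τ : ℍ) (r s m : ℤ) :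
    Complex.exp (2 * Real.pi * Complex.I * ((r * (τ : ℂ) + s) / N - m * τ)) =
      qN N τ ^ (r - m * N) * rootN N s := by
  have hNC : (N : ℂ) ≠ 0 := by exact_mod_cast hN.ne'
  rw [qN, rootN, ← Complex.exp_int_mul, ← Complex.exp_add]
  congr 1
  push_cast
  field_simp
  ring

/-- A division point that is non-zero modulo `N` is not a pole of `℘`. -/
theorem division_point_notMem_lattice {N : ℕ} (hN : 0 < N) (τ : ℍ) {r s : ℤ}
    (h : ¬ ((N : ℤ) ∣ r ∧ (N : ℤ) ∣ s)) :
    ((r : ℂ) * (τ : ℂ) + s) / N ∉ (periods τ).lattice := by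
  have hNC : (N : ℂ) ≠ 0 := by exact_mod_cast hN.ne'
  intro hmem
  obtain ⟨n, m, hnm⟩ := PeriodPair.mem_lattice.mp hmem
  simp only [periods, mul_one] at hnm
  rw [eq_div_iff hNC] at hnm
  have him := congrArg Complex.im hnm
  have hre := congrArg Complex.re hnm
  have hτ : (τ : ℂ).im ≠ 0 := τ.im_ne_zero
  simp only [Complex.mul_im, Complex.mul_re, Complex.add_im, Complex.add_re, Complex.intCast_im,
    Complex.intCast_re, Complex.natCast_im, Complex.natCast_re, mul_zero, zero_mul, zero_add,
    add_zero, sub_zero] at him hre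
  have h1 : (m : ℝ) * N = r := mul_right_cancel₀ hτ (by linear_combination him)
  rw [← h1] at hre
  have h2 : (n : ℝ) * N = s := by linear_combination hre
  exact h ⟨⟨m, by rw [mul_comm]; exact_mod_cast h1.symm⟩,
    ⟨n, by rw [mul_comm]; exact_mod_cast h2.symm⟩⟩

/-- The case `0 ≤ r, r' ≤ N / 2` of the expansion of a difference of division values. If
`r ≠ r'`, the lower of the two powers has a non-zero coefficient; if `r = r'`, the two coefficients
of `q ^ r` differ. -/
theorem exists_wp_sub_of_le {N r r' : ℕ} (hN : 2 < N) (hr : 2 * r ≤ N) (hr' : 2 * r' ≤ N)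
    {s s' : ℤ} (hdet : ¬ (N : ℤ) ∣ r * s' - r' * s) :
    ∃ H : ℂ → ℂ, AnalyticAt ℂ H 0 ∧ H 0 ≠ 0 ∧ ∀ᶠ τ in atImInfty,
      wp N τ (((r : ℤ) : ZMod N), (s : ZMod N)) - wp N τ (((r' : ℤ) : ZMod N), (s' : ZMod N)) =
        qN N τ ^ min r r' * H (qN N τ) := by
  have hN0 : 0 < N := by omega
  obtain ⟨H, hH, hH0, hHs⟩ := exists_analyticAt_hasSum_koebe_int hN0 hr (norm_rootN N s)
  obtain ⟨H', hH', hH'0, hH's⟩ := exists_analyticAt_hasSum_koebe_int hN0 hr' (norm_rootN N s')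
  have hC : ((2 * Real.pi * Complex.I) ^ 2 : ℂ) ≠ 0 := pow_ne_zero 2 Complex.two_pi_I_ne_zero
  have hkoebe : ∀ t : ℤ, ¬ (N : ℤ) ∣ t → koebe (rootN N t) ≠ 0 := by
    intro t ht
    refine div_ne_zero (rootN_ne_zero N t) (pow_ne_zero 2 (sub_ne_zero.mpr ?_))
    rw [← rootN_zero N, Ne, rootN_eq_iff hN0]
    simpa using ht
  refine ⟨fun q => (2 * Real.pi * Complex.I) ^ 2 *
    (q ^ (r - min r r') * H q - q ^ (r' - min r r') * H' q), by fun_prop, ?_, ?_⟩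
  · refine mul_ne_zero hC ?_
    rcases lt_trichotomy r r' with hlt | rfl | hlt
    · have h1 : r' - r ≠ 0 := by omega
      rw [min_eq_left hlt.le, hH0]
      simp only [Nat.sub_self, pow_zero, one_mul, zero_pow h1, zero_mul, sub_zero]
      rw [if_neg (show ¬ 2 * r = N by omega)]
      split_ifs with h0
      · refine hkoebe s fun hs => hdet ?_
        rw [h0, Nat.cast_zero, zero_mul, zero_sub, dvd_neg]
        exact hs.mul_left _
      · exact rootN_ne_zero N s
    · simp only [min_self, Nat.sub_self, pow_zero, one_mul, hH0, hH'0]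
      have hss : ¬ (N : ℤ) ∣ s - s' := fun h => hdet (by
        rw [← mul_sub, ← neg_sub s s', mul_neg, dvd_neg]
        exact h.mul_left _)
      have hne : rootN N s - rootN N s' ≠ 0 :=
        sub_ne_zero.mpr fun h => hss ((rootN_eq_iff hN0 s s').mp h)
      have hr0 : r ≠ 0 := by
        rintro rfl
        simp at hdet
      rw [if_neg hr0, if_neg hr0]
      split_ifs with h1
      · -- `N = 2r` and `N ∤ r (s' - s)` exclude `η η' = 1`;
        -- `η + η⁻¹ - η' - η'⁻¹ = (η - η') (1 - (η η')⁻¹)`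
        have hadd : rootN N s * rootN N s' - 1 ≠ 0 := by
          rw [← rootN_add, ← rootN_zero N, sub_ne_zero, Ne, rootN_eq_iff hN0, sub_zero]
          rintro ⟨k, hk⟩
          refine hdet ⟨r * k - s, ?_⟩
          have h1' : 2 * (r : ℤ) = N := by exact_mod_cast h1
          linear_combination (r : ℤ) * hk - s * h1'
        have hs0 := rootN_ne_zero N s
        have hs'0 := rootN_ne_zero N s'
        have : rootN N s + (rootN N s)⁻¹ - (rootN N s' + (rootN N s')⁻¹) =
            (rootN N s - rootN N s') * (rootN N s * rootN N s' - 1) /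
              (rootN N s * rootN N s') := by
          field_simp
          ring
        rw [this]
        exact div_ne_zero (mul_ne_zero hne hadd) (mul_ne_zero hs0 hs'0)
      · exact hne
    · have h1 : r - r' ≠ 0 := by omega
      rw [min_eq_right hlt.le, hH'0]
      simp only [Nat.sub_self, pow_zero, one_mul, zero_pow h1, zero_mul, zero_sub]
      rw [if_neg (show ¬ 2 * r' = N by omega), neg_ne_zero]
      split_ifs with h0
      · refine hkoebe s' fun hs => hdet ?_
        rw [h0, Nat.cast_zero, zero_mul, sub_zero]
        exact hs.mul_left _
      · exact rootN_ne_zero N s'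
  · filter_upwards [(tendsto_qN hN0).eventually hHs, (tendsto_qN hN0).eventually hH's]
      with τ h1 h2
    have hz : ¬ ((N : ℤ) ∣ (r : ℤ) ∧ (N : ℤ) ∣ s) := fun h =>
      hdet (dvd_sub (h.1.mul_right _) (h.2.mul_left _))
    have hz' : ¬ ((N : ℤ) ∣ (r' : ℤ) ∧ (N : ℤ) ∣ s') := fun h =>
      hdet (dvd_sub (h.2.mul_left _) (h.1.mul_right _))
    have h := hasSum_weierstrassP_sub τ (division_point_notMem_lattice hN0 τ hz)
      (division_point_notMem_lattice hN0 τ hz')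
    simp only [exp_division_point hN0] at h
    rw [wp_intCast N hN0, wp_intCast N hN0, h.unique ((h1.sub h2).mul_left _)]
    have e1 : qN N τ ^ r = qN N τ ^ min r r' * qN N τ ^ (r - min r r') := by
      rw [← pow_add]; congr 1; omega
    have e2 : qN N τ ^ r' = qN N τ ^ min r r' * qN N τ ^ (r' - min r r') := by
      rw [← pow_add]; congr 1; omega
    rw [e1, e2]
    ring

theorem wp_neg {N : ℕ} (hN : 0 < N) (τ : ℍ) (r s : ℤ) :
    wp N τ (((-r : ℤ) : ZMod N), ((-s : ℤ) : ZMod N)) = wp N τ ((r : ZMod N), (s : ZMod N)) := by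
  rw [wp_intCast N hN, wp_intCast N hN, ← PeriodPair.weierstrassP_neg]
  congr 1
  push_cast
  ring

/-- As `℘` is even and periodic, the first coordinate of a division point may be replaced by
`{r}`. -/
theorem exists_reduced_division_point {N : ℕ} (hN : 0 < N) (r s : ℤ) :
    ∃ (r₀ : ℕ) (s₀ ε : ℤ), 2 * r₀ ≤ N ∧ (r₀ : ℤ) = br N r ∧ IsUnit ε ∧
      r₀ ≡ ε * r [ZMOD N] ∧ s₀ = ε * s ∧
      ∀ τ, wp N τ ((r : ZMod N), (s : ZMod N)) = wp N τ (((r₀ : ℤ) : ZMod N), (s₀ : ZMod N)) := by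
  obtain ⟨h0, h2, h⟩ := (br_eq_iff N hN r (br N r)).mp rfl
  have hc : (((br N r).toNat : ℕ) : ℤ) = br N r := Int.toNat_of_nonneg h0
  rcases h with h | h
  · refine ⟨(br N r).toNat, s, 1, by omega, hc, isUnit_one, by rw [hc, one_mul]; exact h.symm,
      by ring, fun τ => ?_⟩
    rw [hc, (ZMod.intCast_eq_intCast_iff _ _ _).mpr h]
  · have h' : br N r ≡ -r [ZMOD N] := by simpa using h.symm.neg
    refine ⟨(br N r).toNat, -s, -1, by omega, hc, isUnit_one.neg,
      by rw [hc, neg_one_mul]; exact h', by ring, fun τ => ?_⟩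
    rw [hc, (ZMod.intCast_eq_intCast_iff _ _ _).mpr h', wp_neg hN]

/-- The difference of the values of `℘` at two `N`-division points that form a basis has order
`min ({r}, {r'})` in `q`. -/
theorem exists_wp_sub {N : ℕ} (hN : 2 < N) {r s r' s' : ℤ} (hdet : IsUnit (r * s' - r' * s)) :
    ∃ H : ℂ → ℂ, AnalyticAt ℂ H 0 ∧ H 0 ≠ 0 ∧ ∀ᶠ τ in atImInfty,
      wp N τ ((r : ZMod N), (s : ZMod N)) - wp N τ ((r' : ZMod N), (s' : ZMod N)) =
        qN N τ ^ min (br N r) (br N r') * H (qN N τ) := by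
  obtain ⟨r₀, s₀, ε, hr₀, hbr, hε, hrr, hss, hwp⟩ :=
    exists_reduced_division_point (show 0 < N by omega) r s
  obtain ⟨r₁, s₁, δ, hr₁, hbr', hδ, hrr', hss', hwp'⟩ :=
    exists_reduced_division_point (show 0 < N by omega) r' s'
  have hcong : r₀ * s₁ - r₁ * s₀ ≡ ε * δ * (r * s' - r' * s) [ZMOD N] := by
    have := (hrr.mul_right s₁).sub (hrr'.mul_right s₀)
    rw [hss, hss'] at this ⊢
    convert this using 1
    ring
  have hdet' : ¬ (N : ℤ) ∣ r₀ * s₁ - r₁ * s₀ := by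
    intro h
    have h1 := dvd_add hcong.dvd h
    rw [sub_add_cancel] at h1
    have := isUnit_of_dvd_unit h1 ((hε.mul hδ).mul hdet)
    rw [Int.isUnit_iff] at this
    omega
  obtain ⟨H, hH, hH0, hHf⟩ := exists_wp_sub_of_le hN hr₀ hr₁ hdet'
  refine ⟨H, hH, hH0, hHf.mono fun τ hτ => ?_⟩
  rw [hwp, hwp', hτ, ← hbr, ← hbr', ← Nat.cast_min, zpow_natCast]

/-! ### The action of the modular group -/

/-- Homogeneity of `℘`: `A` acts on division points by multiplication from the right. -/
theorem wp_smul {N : ℕ} (hN : 0 < N) (A : SL(2, ℤ)) (τ : ℍ) (r s : ℤ) :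
    wp N (A • τ) ((r : ZMod N), (s : ZMod N)) = denom A τ ^ 2 *
      wp N τ (((r * A 0 0 + s * A 1 0 : ℤ) : ZMod N), ((r * A 0 1 + s * A 1 1 : ℤ) : ZMod N)) := by
  have hd : denom A τ = A 1 0 * (τ : ℂ) + A 1 1 := by simp [denom]
  have hd0 : denom A τ ≠ 0 := denom_ne_zero _ _
  have hnum : ((A • τ : ℍ) : ℂ) * denom A τ = A 0 0 * (τ : ℂ) + A 0 1 := by
    have hd1 : (A 1 0 * (τ : ℂ) + A 1 1 : ℂ) ≠ 0 := hd ▸ hd0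
    rw [hd, coe_specialLinearGroup_apply]
    simpa using div_mul_cancel₀ _ hd1
  have hdet : A 0 0 * A 1 1 - A 0 1 * A 1 0 = 1 := by
    rw [← Matrix.det_fin_two]; exact A.det_coe
  have hdetC : (A 0 0 * A 1 1 - A 0 1 * A 1 0 : ℂ) = 1 := by exact_mod_cast hdet
  rw [wp_intCast N hN, wp_intCast N hN, weierstrassP_of_lattice_smul (M := periods τ) hd0]
  · congr 2
    push_cast
    rw [mul_div_assoc', mul_add, mul_left_comm, mul_comm (denom A τ) (A • τ : ℍ), hnum, hd]
    ring
  · intro x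
    simp only [PeriodPair.mem_lattice, periods, mul_one]
    constructor
    · rintro ⟨n, m, rfl⟩
      refine ⟨m * A 0 1 + n * A 1 1, m * A 0 0 + n * A 1 0, ?_⟩
      push_cast
      linear_combination (n : ℂ) * (-hd) - m * hnum
    · rintro ⟨n, m, h⟩
      refine ⟨n * A 0 0 - m * A 0 1, m * A 1 1 - n * A 1 0, mul_left_cancel₀ hd0 ?_⟩
      rw [← h]
      push_cast
      linear_combination ((n : ℂ) * A 0 0 - m * A 0 1) * hd +
        ((m : ℂ) * A 1 1 - n * A 1 0) * hnum + ((n : ℂ) + m * τ) * hdetC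

theorem compAct_Lambda {N : ℕ} (hN : 0 < N) (A : SL(2, ℤ)) (τ : ℍ) :
    compAct (Lambda N) A τ =
      (wp N τ ((A 0 0 : ZMod N), (A 0 1 : ZMod N)) -
        wp N τ (((A 0 0 + A 1 0 : ℤ) : ZMod N), ((A 0 1 + A 1 1 : ℤ) : ZMod N))) /
      (wp N τ ((A 1 0 : ZMod N), (A 1 1 : ZMod N)) -
        wp N τ (((A 0 0 + A 1 0 : ℤ) : ZMod N), ((A 0 1 + A 1 1 : ℤ) : ZMod N))) := by
  have h1 := wp_smul hN A τ 1 0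
  have h2 := wp_smul hN A τ 0 1
  have h3 := wp_smul hN A τ 1 1
  simp only [one_mul, zero_mul, add_zero, zero_add, Int.cast_one, Int.cast_zero] at h1 h2 h3
  have hd0 : denom A τ ≠ 0 := denom_ne_zero _ _
  rw [compAct, Lambda, LambdaQ, Prod.mk_add_mk, add_zero, zero_add, h1, h2, h3, ← mul_sub,
    ← mul_sub, mul_div_mul_left _ _ (pow_ne_zero 2 hd0)]

/-- The two pairs of division points in the numerator and the denominator of `Λ ∘ A` have
determinants `1` and `-1`. -/
theorem exists_hasQExpansion_compAct {N : ℕ} (hN : 2 < N) (A : SL(2, ℤ)) :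
    ∃ F : LaurentSeries ℂ, F ≠ 0 ∧ HasQExpansion N (compAct (Lambda N) A) F ∧
      F.order = min (br N (A 0 0)) (br N (A 0 0 + A 1 0)) -
        min (br N (A 1 0)) (br N (A 0 0 + A 1 0)) := by
  have hN0 : 0 < N := by omega
  have hdet : A 0 0 * A 1 1 - A 0 1 * A 1 0 = 1 := by
    rw [← Matrix.det_fin_two]; exact A.det_coe
  obtain ⟨H, hH, hH0, hHf⟩ := exists_wp_sub hN (r := A 0 0) (s := A 0 1) (r' := A 0 0 + A 1 0)
    (s' := A 0 1 + A 1 1) (Int.isUnit_iff.mpr (Or.inl (by linear_combination hdet)))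
  obtain ⟨K, hK, hK0, hKf⟩ := exists_wp_sub hN (r := A 1 0) (s := A 1 1) (r' := A 0 0 + A 1 0)
    (s' := A 0 1 + A 1 1) (Int.isUnit_iff.mpr (Or.inr (by linear_combination -hdet)))
  refine exists_hasQExpansion_of_analyticAt hN0 (hH.div hK hK0) (div_ne_zero hH0 hK0) ?_
  filter_upwards [hHf, hKf] with τ h1 h2
  have hq : qN N τ ≠ 0 := Complex.exp_ne_zero _
  rw [compAct_Lambda hN0, h1, h2, zpow_sub₀ hq, mul_div_mul_comm]
  rfl

theorem nu_eq {N : ℕ} (hN : 2 < N) (A : SL(2, ℤ)) :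
    nu N A = min (br N (A 0 0)) (br N (A 0 0 + A 1 0)) -
      min (br N (A 1 0)) (br N (A 0 0 + A 1 0)) := by
  obtain ⟨F, -, hF, hord⟩ := exists_hasQExpansion_compAct hN A
  rw [nu, hF.qExpansion_eq (by omega), hord]

/-! ### The integer `{x}` and the cusps -/

theorem br_congr {N : ℕ} {x y : ℤ} (h : x ≡ y [ZMOD N]) : br N x = br N y := by
  unfold br
  rw [h]

theorem br_neg {N : ℕ} (hN : 0 < N) (x : ℤ) : br N (-x) = br N x := by
  obtain ⟨h0, h2, h⟩ := (br_eq_iff N hN x (br N x)).mp rfl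
  refine (br_eq_iff N hN (-x) (br N x)).mpr ⟨h0, h2, ?_⟩
  rcases h with h | h
  · exact Or.inr h.neg
  · exact Or.inl (by simpa using h.neg)

theorem mul_T_zpow_apply_zero (A : SL(2, ℤ)) (i : ℤ) (j : Fin 2) :
    (A * ModularGroup.T ^ i) j 0 = A j 0 := by
  rw [Matrix.SpecialLinearGroup.coe_mul, ModularGroup.coe_T_zpow]
  simp [Matrix.mul_apply]

theorem partner_apply (A : SL(2, ℤ)) : partner A 0 0 = A 1 0 ∧ partner A 1 0 = A 0 0 :=
  ⟨rfl, rfl⟩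

end GenLambda

theorem proposition3p2 (N : ℕ) (hN : 2 < N) :
    -- `Λ ∘ A` has a non-zero `q`-expansion, so that its order `ν(A)` makes sense
    (∀ A : SL(2, ℤ), ∃ F : LaurentSeries ℂ, F ≠ 0 ∧
      GenLambda.HasQExpansion N (GenLambda.compAct (GenLambda.Lambda N) A) F) ∧
    -- the formula for the order
    (∀ (A : SL(2, ℤ)) (a c : ℤ), A 0 0 ≡ a [ZMOD N] → A 1 0 ≡ c [ZMOD N] →
      GenLambda.nu N A =
        min (GenLambda.br N a) (GenLambda.br N (a + c)) -
          min (GenLambda.br N c) (GenLambda.br N (a + c))) ∧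
    -- paired representatives `A`, `A'` of the cusps `(a, c)`, `(c, a)` with `a ≢ ±c`
    (∀ A : SL(2, ℤ), ¬ A 0 0 ≡ A 1 0 [ZMOD N] → ¬ A 0 0 ≡ -A 1 0 [ZMOD N] →
      ∀ i : ℤ, GenLambda.nu N A = GenLambda.nu N (A * ModularGroup.T ^ i) ∧
        GenLambda.nu N (A * ModularGroup.T ^ i) =
          -GenLambda.nu N (GenLambda.partner A * ModularGroup.T ^ i)) ∧
    -- representatives of the cusps `(a, c)` with `a ≡ ±c`
    (∀ A : SL(2, ℤ), (A 0 0 ≡ A 1 0 [ZMOD N] ∨ A 0 0 ≡ -A 1 0 [ZMOD N]) →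
      ∀ i : ℤ, GenLambda.nu N (A * ModularGroup.T ^ i) = 0) := by
  refine ⟨fun A => ?_, fun A a c ha hc => ?_, fun A _ _ i => ⟨?_, ?_⟩, fun A h i => ?_⟩
  · obtain ⟨F, hF0, hF, -⟩ := GenLambda.exists_hasQExpansion_compAct hN A
    exact ⟨F, hF0, hF⟩
  · rw [GenLambda.nu_eq hN, GenLambda.br_congr ha, GenLambda.br_congr hc,
      GenLambda.br_congr (ha.add hc)]
  · simp only [GenLambda.nu_eq hN, GenLambda.mul_T_zpow_apply_zero]
  · simp only [GenLambda.nu_eq hN, GenLambda.mul_T_zpow_apply_zero, GenLambda.partner_apply,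
      add_comm (A 1 0)]
    ring
  · have hbr : GenLambda.br N (A 0 0) = GenLambda.br N (A 1 0) := by
      rcases h with h | h
      · exact GenLambda.br_congr h
      · rw [GenLambda.br_congr h, GenLambda.br_neg (by omega)]
    rw [GenLambda.nu_eq hN]
    simp only [GenLambda.mul_T_zpow_apply_zero, hbr, sub_self]
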